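/- Let $V$ be a transitive model of ZF (a transitive set or a transitive proper class, for instance the universe of sets), and let $\mathcal A=(A,B,\prec,\bot\!\!\!\bot)$ be a realizability algebra in $V$: $A,B\in V$, $B\neq\emptyset$; $\Lambda$ and $\Pi$ are the sets of closed $\lambda_c$-terms (built from variables, application, abstraction, $\mathsf{cc}$, a continuation constant $k_\pi$ for each stack $\pi$, and special instructions $\xi_a$, $a\in A$) and of stacks (built from stack bottoms $\omega_b$, $b\in B$, by pushing closed terms, $t\cdot\pi$); $\prec\,\in V$ is a preorder on $\Lambda\times\Pi$ extending the evaluation preorder generated by $$ts\star\pi\succ t\star s\cdot\pi,\quad \lambda u.t\star s\cdot\pi\succ t[u:=s]\star\pi,\quad \mathsf{cc}\star t\cdot\pi\succ t\star k_\pi\cdot\pi,\quad k_\sigma\star t\cdot\pi\succ t\star\sigma;$$ and $\bot\!\!\!\bot\in V$ is a subset of $\Lambda\times\Pi$ such that $p\succ q\in\bot\!\!\!\bot$ implies $p\in\bot\!\!\!\bot$. Let $N$ be the class of names in $V$, i.e. of the sets in $V$ that hereditarily consist of pairs (name, stack). Formulas in the relations $\notin,\subseteq,\not\mathrel{\varepsilon},\neq$,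 built with $\top,\bot,\to,\forall$ and with parameters in $N$, have truth values $|\varphi|=\{t\in\Lambda:\forall\pi\in\|\varphi\|\ \, t\star\pi\in\bot\!\!\!\bot\}$ and falsity values $\|\varphi\|\subseteq\Pi$ given by $\|\top\|=\emptyset$; $\|\bot\|=\Pi$; $\|a\not\mathrel{\varepsilon} b\|=\{\pi:(a,\pi)\in b\}$; $\|a\ne b\|=\emptyset$ if $a\neq b$ and $\Pi$ otherwise; $\|a\notin b\|=\{t\cdot t'\cdot\pi:\exists c\,((c,\pi)\in b,\ t\in|a\subseteq c|,\ t'\in|c\subseteq a|)\}$; $\|a\subseteq b\|=\{t\cdot\pi:\exists c\,((c,\pi)\in a,\ t\in|c\notin b|)\}$; $\|\varphi\to\psi\|=\{t\cdot\pi:t\in|\varphi|,\ \pi\in\|\psi\|\}$; $\|\forall x\,\varphi\|=\bigcup_{a\in N}\|\varphi[a/x]\|$. The other connectives and $\exists$ are De Morgan abbreviations, $x\in y$ is $x\notin y\to\bot$, and $x\simeq y$ is $x\subseteq y\wedge y\subseteq x$. Write $\mathcal N\Vdash\varphi$ if $\varphi$ has its parameters in $N$ and some closed term without continuation constants belongs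 to $|\varphi|$. For a set $x\in V$ define its recursive name by $\mathbf r(x)=\{(\mathbf r(y),\pi): y\in x,\ \pi\in\Pi\}$. Then the following holds. 1. If $\alpha,\beta\in V$ are ordinals with $\alpha=\beta+1=\beta\cup\{\beta\}$, then $\mathcal N\Vdash$ "$\mathbf r(\alpha)$ is the $\in$-successor of $\mathbf r(\beta)$", i.e. $\mathcal N\Vdash\forall z\,(z\in \mathbf r(\alpha)\leftrightarrow z\in \mathbf r(\beta)\vee z\simeq \mathbf r(\beta))$; and $\mathcal N\Vdash \mathbf r(\alpha)\simeq \mathbf r(\beta)+1$, i.e. $\mathcal N\Vdash\exists s\,(\forall z\,(z\in s\leftrightarrow z\in \mathbf r(\beta)\vee z\simeq \mathbf r(\beta))\wedge \mathbf r(\alpha)\simeq s)$. 2. In particular, for every $n\in\omega$, $\mathcal N\Vdash$ "$\mathbf r(n)$ is the $n$-th successor of $\emptyset$", where "$x$ is the $0$-th successor of $\emptyset$" is $\forall z\,(z\notin x)$, and "$x$ is the $(k+1)$-st successor of $\emptyset$" is: there is $y$ that is the $k$-th successor of $\emptyset$ and $x$ is the $\in$-successor of $y$. -/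

import Mathlib

/-! ## Models of ZF -/

universe u v

namespace RealizabilityZF

/-- The only relation symbol of the first-order language of set theory. -/
inductive SetRel : ℕ → Type
  | mem : SetRel 2

/-- The first-order language of set theory, with one binary relation symbol. -/
def setLang : FirstOrder.Language.{0, 0} where
  Functions := fun _ => Empty
  Relations := SetRel

/-- A binary relation `E` on `M` as a structure for the language of set theory. -/
@[reducible] def setStructure {M : Type v} (E : M → M → Prop) : setLang.Structure M where
  funMap := fun f => Empty.elim f
  RelMap := fun r => match r with
    | SetRel.mem => fun x => E (x 0) (x 1)

/-- `S` is first-order definable with parameters in `(M, E)`. -/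
def DefinableClass {M : Type v} (E : M → M → Prop) (S : Set M) : Prop :=
  letI := setStructure E
  (Set.univ : Set M).Definable₁ setLang S

/-- `R` is a binary relation that is first-order definable with parameters in `(M, E)`. -/
def DefinableRel {M : Type v} (E : M → M → Prop) (R : Set (M × M)) : Prop :=
  letI := setStructure E
  (Set.univ : Set M).Definable₂ setLang R

/-- `(M, E)` satisfies the axioms of Zermelo-Fraenkel set theory (without choice). -/
structure ModelsZF {M : Type v} (E : M → M → Prop) : Prop where
  extensionality : ∀ x y, (∀ z, E z x ↔ E z y) → x = y
  foundation : ∀ x, (∃ y, E y x) → ∃ y, E y x ∧ ∀ z, E z y → ¬ E z x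
  pairing : ∀ x y, ∃ z, ∀ w, E w z ↔ w = x ∨ w = y
  union : ∀ x, ∃ y, ∀ w, E w y ↔ ∃ z, E z x ∧ E w z
  powerset : ∀ x, ∃ y, ∀ w, E w y ↔ ∀ z, E z w → E z x
  infinity : ∃ w, (∃ e, E e w ∧ ∀ z, ¬ E z e) ∧
    ∀ x, E x w → ∃ y, E y w ∧ ∀ z, E z y ↔ E z x ∨ z = x
  separation : ∀ S : Set M, DefinableClass E S → ∀ x, ∃ y, ∀ z, E z y ↔ E z x ∧ z ∈ S
  replacement : ∀ R : Set (M × M), DefinableRel E R →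
    ∀ x, (∀ y, E y x → ∃! z, (y, z) ∈ R) → ∃ w, ∀ z, E z w ↔ ∃ y, E y x ∧ (y, z) ∈ R

/-- `V` is a transitive model of ZF: a transitive class of sets (possibly a set, possibly a proper
class such as the whole universe) that satisfies ZF with the true membership relation. -/
structure IsTransitiveModelZF (V : Set ZFSet.{u}) : Prop where
  transitive : ∀ x ∈ V, ∀ y ∈ x, y ∈ V
  models : ModelsZF (fun x y : V => (x : ZFSet) ∈ (y : ZFSet))

/-! ## Terms, stacks, evaluation -/

mutual
/-- The `λ_c`-terms whose free variables are among `n` given ones, up to renaming of bound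
variables (de Bruijn indices; the index `0` is the variable bound last). -/
inductive Term (A B : Type u) : ℕ → Type u
  | var {n : ℕ} : Fin n → Term A B n
  | app {n : ℕ} : Term A B n → Term A B n → Term A B n
  | lam {n : ℕ} : Term A B (n + 1) → Term A B n
  | cc {n : ℕ} : Term A B n
  | cont {n : ℕ} : Stack A B → Term A B n
  | instr {n : ℕ} : A → Term A B n
/-- Stacks: a stack bottom, or a closed term pushed on a stack. -/
inductive Stack (A B : Type u) : Type u
  | bottom : B → Stack A B
  | push : Term A B 0 → Stack A B → Stack A B
end

namespace Term

variable {A B : Type u}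

/-- Renaming of free variables. -/
def rename : {n m : ℕ} → (Fin n → Fin m) → Term A B n → Term A B m
  | _, _, f, var i => var (f i)
  | _, _, f, app t s => app (rename f t) (rename f s)
  | _, _, f, lam t => lam (rename (Fin.cases 0 fun i => (f i).succ) t)
  | _, _, _, cc => cc
  | _, _, _, cont π => cont π
  | _, _, _, instr a => instr a

/-- Simultaneous capture-avoiding substitution. (Stacks hold closed terms only.) -/
def subst : {n m : ℕ} → (Fin n → Term A B m) → Term A B n → Term A B m
  | _, _, f, var i => f i
  | _, _, f, app t s => app (subst f t) (subst f s)
  | _, _, f, lam t => lam (subst (Fin.cases (var 0) fun i => rename Fin.succ (f i)) t)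
  | _, _, _, cc => cc
  | _, _, _, cont π => cont π
  | _, _, _, instr a => instr a

/-- `t[u := s]` for the only free variable `u` of `t` and a closed term `s`. -/
def inst (t : Term A B 1) (s : Term A B 0) : Term A B 0 :=
  subst (fun _ => s) t

/-- The term contains no continuation constant. -/
def NoCont : {n : ℕ} → Term A B n → Prop
  | _, var _ => True
  | _, app t s => NoCont t ∧ NoCont s
  | _, lam t => NoCont t
  | _, cc => True
  | _, cont _ => False
  | _, instr _ => True

end Term

/-- A pair `t ⋆ π` of a closed term and a stack. -/
abbrev Proc (A B : Type u) : Type u := Term A B 0 × Stack A B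

/-- One step of evaluation: push, grab, save, restore. -/
inductive Step {A B : Type u} : Proc A B → Proc A B → Prop
  | push (t s : Term A B 0) (π : Stack A B) : Step (Term.app t s, π) (t, Stack.push s π)
  | grab (t : Term A B 1) (s : Term A B 0) (π : Stack A B) :
      Step (Term.lam t, Stack.push s π) (t.inst s, π)
  | save (t : Term A B 0) (π : Stack A B) :
      Step (Term.cc, Stack.push t π) (t, Stack.push (Term.cont π) π)
  | restore (t : Term A B 0) (π σ : Stack A B) :
      Step (Term.cont σ, Stack.push t π) (t, σ)

/-! ## Terms and stacks as sets -/

/-- The finite von Neumann ordinals. -/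
def finOrd : ℕ → ZFSet.{u}
  | 0 => ∅
  | n + 1 => insert (finOrd n) (finOrd n)

mutual
/-- Terms as sets, by tagged ordered pairs, where `f` and `g` give the indices of the special
instructions and of the stack bottoms. -/
noncomputable def termCode {A B : Type u} (f : A → ZFSet.{u}) (g : B → ZFSet.{u}) :
    {n : ℕ} → Term A B n → ZFSet.{u}
  | _, Term.var i => ZFSet.pair (finOrd 0) (finOrd i.val)
  | _, Term.app t s => ZFSet.pair (finOrd 1) (ZFSet.pair (termCode f g t) (termCode f g s))
  | _, Term.lam t => ZFSet.pair (finOrd 2) (termCode f g t)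
  | _, Term.cc => ZFSet.pair (finOrd 3) ∅
  | _, Term.cont π => ZFSet.pair (finOrd 4) (stackCode f g π)
  | _, Term.instr a => ZFSet.pair (finOrd 5) (f a)
/-- Stacks as sets. -/
noncomputable def stackCode {A B : Type u} (f : A → ZFSet.{u}) (g : B → ZFSet.{u}) :
    Stack A B → ZFSet.{u}
  | Stack.bottom b => ZFSet.pair (finOrd 6) (g b)
  | Stack.push t π => ZFSet.pair (finOrd 7) (ZFSet.pair (termCode f g t) (stackCode f g π))
end

/-- The elements of a set `X`, as a type in the universe of the index types of terms. -/
abbrev Elts (X : ZFSet.{u}) : Type u := Shrink.{u} X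

/-- The element of `X` named by a member of `Elts X`. -/
noncomputable def eltVal {X : ZFSet.{u}} (a : Elts X) : ZFSet.{u} := ((equivShrink X).symm a).val

/-- The set that codes a stack over two sets `A`, `B` of indices. -/
noncomputable def codeS {A B : ZFSet.{u}} (π : Stack (Elts A) (Elts B)) : ZFSet.{u} :=
  stackCode eltVal eltVal π

/-- The set that codes a process over two sets `A`, `B` of indices. -/
noncomputable def codeP {A B : ZFSet.{u}} (p : Proc (Elts A) (Elts B)) : ZFSet.{u} :=
  ZFSet.pair (termCode eltVal eltVal p.1) (codeS p.2)

/-! ## Realizability algebras -/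

/-- A realizability algebra `(A, B, ≺, ⫫)` in `V`. -/
structure RealizabilityAlgebra (V : Set ZFSet.{u}) where
  A : ZFSet.{u}
  B : ZFSet.{u}
  A_mem : A ∈ V
  B_mem : B ∈ V
  B_nonempty : ∃ b, b ∈ B
  /-- `red p q` means `p ≻ q`. -/
  red : Proc (Elts A) (Elts B) → Proc (Elts A) (Elts B) → Prop
  red_refl : ∀ p, red p p
  red_trans : ∀ p q r, red p q → red q r → red p r
  red_of_step : ∀ p q, Step p q → red p q
  /-- The relation is an element of `V`. -/
  red_mem : ZFSet.range (fun p : {p : Proc (Elts A) (Elts B) × Proc (Elts A) (Elts B) //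
    red p.1 p.2} => ZFSet.pair (codeP p.1.1) (codeP p.1.2)) ∈ V
  pole : Set (Proc (Elts A) (Elts B))
  pole_closed : ∀ p q, red p q → q ∈ pole → p ∈ pole
  /-- The pole is an element of `V`. -/
  pole_mem : ZFSet.range (fun p : pole => codeP p.1) ∈ V

namespace RealizabilityAlgebra

variable {V : Set ZFSet.{u}} (𝒜 : RealizabilityAlgebra V)

/-- The closed terms `Λ`. -/
abbrev Tm : Type u := Term (Elts 𝒜.A) (Elts 𝒜.B) 0

/-- The stacks `Π`. -/
abbrev Stk : Type u := Stack (Elts 𝒜.A) (Elts 𝒜.B)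

/-- The terms that are incompatible with all stacks in `S`. -/
def orth (S : Set 𝒜.Stk) : Set 𝒜.Tm := {t | ∀ π ∈ S, (t, π) ∈ 𝒜.pole}

/-! ## Names -/

/-- The names over the stacks of `𝒜`: the sets all of whose elements are pairs `(c, π)` of a name
and a stack, hereditarily. -/
inductive IsName : ZFSet.{u} → Prop
  | mk (x : ZFSet.{u}) (hpair : ∀ z ∈ x, ∃ (c : ZFSet.{u}) (π : 𝒜.Stk), z = ZFSet.pair c (codeS π))
      (hname : ∀ (c : ZFSet.{u}) (π : 𝒜.Stk), ZFSet.pair c (codeS π) ∈ x → IsName c) : IsName x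

/-- The class `N` of the names that belong to `V`. -/
def N : Set ZFSet.{u} := {a | a ∈ V ∧ 𝒜.IsName a}

/-- The recursive name of `x`, which consists of all pairs of the recursive name of an element
of `x` and a stack. -/
noncomputable def reish (x : ZFSet.{u}) : ZFSet.{u} :=
  ZFSet.range (fun p : x × 𝒜.Stk => ZFSet.pair (reish p.1.val) (codeS p.2))
termination_by x
decreasing_by exact p.1.2

/-! ## Truth and falsity values -/

theorem rank_lt_of_pair_mem {a c p : ZFSet.{u}} (h : ZFSet.pair c p ∈ a) :
    c.rank < a.rank := by
  refine lt_trans ?_ (ZFSet.rank_lt_of_mem h)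
  have h1 : c ∈ ({c} : ZFSet.{u}) := by simp
  have h2 : ({c} : ZFSet.{u}) ∈ ZFSet.pair c p := by simp [ZFSet.pair]
  exact (ZFSet.rank_lt_of_mem h1).trans (ZFSet.rank_lt_of_mem h2)

mutual
/-- The falsity value of `a ∉ b`. -/
noncomputable def falNotMem (a b : ZFSet.{u}) : Set 𝒜.Stk :=
  {ρ | ∃ (c : ZFSet.{u}) (π : 𝒜.Stk) (_ : ZFSet.pair c (codeS π) ∈ b) (t t' : 𝒜.Tm),
    ρ = Stack.push t (Stack.push t' π) ∧
    t ∈ 𝒜.orth (falSubset a c) ∧ t' ∈ 𝒜.orth (falSubset c a)}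
termination_by (max a.rank b.rank, min a.rank b.rank)
decreasing_by
  all_goals
    have hr := rank_lt_of_pair_mem (by assumption)
    rw [Prod.lex_def]
    grind
/-- The falsity value of `a ⊆ b`. -/
noncomputable def falSubset (a b : ZFSet.{u}) : Set 𝒜.Stk :=
  {ρ | ∃ (c : ZFSet.{u}) (π : 𝒜.Stk) (_ : ZFSet.pair c (codeS π) ∈ a) (t : 𝒜.Tm),
    ρ = Stack.push t π ∧ t ∈ 𝒜.orth (falNotMem c b)}
termination_by (max a.rank b.rank, min a.rank b.rank)
decreasing_by
  all_goals
    have hr := rank_lt_of_pair_mem (by assumption)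
    rw [Prod.lex_def]
    grind
end

end RealizabilityAlgebra

/-! ## Formulas -/

/-- The formulas of the language with the binary relation symbols `∉`, `⊆`, `ε̸`, `≠`, with free
variables among `n` given ones. The quantifier binds the variable `0` and shifts the others. -/
inductive Fml : ℕ → Type
  | top {n : ℕ} : Fml n
  | bot {n : ℕ} : Fml n
  | notMem {n : ℕ} : Fin n → Fin n → Fml n
  | subset {n : ℕ} : Fin n → Fin n → Fml n
  | notEps {n : ℕ} : Fin n → Fin n → Fml n
  | ne {n : ℕ} : Fin n → Fin n → Fml n
  | imp {n : ℕ} : Fml n → Fml n → Fml n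
  | all {n : ℕ} : Fml (n + 1) → Fml n

namespace Fml

variable {n : ℕ}

/-- Negation. -/
def neg (φ : Fml n) : Fml n := imp φ bot

/-- Conjunction `(φ → (ψ → ⊥)) → ⊥`. -/
def and (φ ψ : Fml n) : Fml n := imp (imp φ (imp ψ bot)) bot

/-- Disjunction `(φ → ⊥) → ((ψ → ⊥) → ⊥)`. -/
def or (φ ψ : Fml n) : Fml n := imp (imp φ bot) (imp (imp ψ bot) bot)

/-- Equivalence `(φ → ψ) ∧ (ψ → φ)`. -/
def iff (φ ψ : Fml n) : Fml n := and (imp φ ψ) (imp ψ φ)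

/-- Existential quantifier `(∀ x (φ → ⊥)) → ⊥`. -/
def ex (φ : Fml (n + 1)) : Fml n := imp (all (imp φ bot)) bot

/-- `x ∈ y`. -/
def mem (i j : Fin n) : Fml n := neg (notMem i j)

/-- `x ≃ y`, that is `x ⊆ y ∧ y ⊆ x`. -/
def simeq (i j : Fin n) : Fml n := and (subset i j) (subset j i)

/-- `x` is the `∈`-successor of `y`: `∀ z (z ∈ x ↔ z ∈ y ∨ z ≃ y)`. -/
def isSucc (i j : Fin n) : Fml n :=
  all (iff (mem 0 i.succ) (or (mem 0 j.succ) (simeq 0 j.succ)))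

/-- `x ≃ y + 1`: there is some `s` that is the `∈`-successor of `y`, and `x ≃ s`. -/
def simeqSucc (i j : Fin n) : Fml n :=
  ex (and (isSucc 0 j.succ) (simeq i.succ 0))

/-- `x` is empty: `∀ z (z ∉ x)`. -/
def isEmpty (i : Fin n) : Fml n := all (notMem 0 i.succ)

/-- `x` is the `k`-th successor of the empty set. -/
def isNthSucc : ℕ → {n : ℕ} → Fin n → Fml n
  | 0, _, i => isEmpty i
  | k + 1, _, i => ex (and (isNthSucc k 0) (isSucc i.succ 0))

end Fml

namespace RealizabilityAlgebra

variable {V : Set ZFSet.{u}} (𝒜 : RealizabilityAlgebra V)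

/-- The falsity value of the formula `φ` with the parameters `v` for its free variables. -/
noncomputable def falsity : {n : ℕ} → Fml n → (Fin n → ZFSet.{u}) → Set 𝒜.Stk
  | _, Fml.top, _ => ∅
  | _, Fml.bot, _ => Set.univ
  | _, Fml.notMem i j, v => 𝒜.falNotMem (v i) (v j)
  | _, Fml.subset i j, v => 𝒜.falSubset (v i) (v j)
  | _, Fml.notEps i j, v => {π | ZFSet.pair (v i) (codeS π) ∈ v j}
  | _, Fml.ne i j, v => {_π | v i = v j}
  | _, Fml.imp φ ψ, v =>
      {ρ | ∃ t π, ρ = Stack.push t π ∧ t ∈ 𝒜.orth (falsity φ v) ∧ π ∈ falsity ψ v}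
  | _, Fml.all φ, v => {π | ∃ a ∈ 𝒜.N, π ∈ falsity φ (Fin.cons a v)}

/-- `t ⊩ φ`: the closed term `t` is in the truth value of `φ`. -/
def Realizes (t : 𝒜.Tm) {n : ℕ} (φ : Fml n) (v : Fin n → ZFSet.{u}) : Prop :=
  t ∈ 𝒜.orth (𝒜.falsity φ v)

/-- `𝒩 ⊩ φ` for the realizability model `𝒩 = (V, 𝒜)`: the formula `φ` with the parameters `v`,
which are names in `V`, belongs to the realizability theory, that is, it is realized by a closed
term without continuation constants. -/
def Forces {n : ℕ} (φ : Fml n) (v : Fin n → ZFSet.{u}) : Prop :=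
  (∀ i, v i ∈ 𝒜.N) ∧ ∃ t : 𝒜.Tm, t.NoCont ∧ 𝒜.Realizes t φ v

end RealizabilityAlgebra

end RealizabilityZF

namespace RealizabilityZF

/-! ## Substitution -/

namespace Term

variable {A B : Type u}

-- The heart of the matter is comparability of recursive names of ordinals: one closed term `C`
-- realizes r(y) ∉ r(x) → r(x) ⊆ r(y) for all ordinals x, y (`compareTm_mem`). It satisfies C t ⋆
-- s·π ≻ t ⋆ C s·C t·π, and correctness follows by a double ∈-induction.
--
-- Let z ∈ r(β+1). Then z ≃ r(γ) for some γ ∈ β+1, so γ ⊆ β and z ⊆ r(β). No single realizer can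
-- read off whether γ ∈ β or γ = β, so the disjunction is settled inside the model: if z ∉ r(β),
-- then r(γ) ∉ r(β), comparability gives r(β) ⊆ r(γ) ⊆ z, and z ≃ r(β) (`realizes_succ_mp`). This
-- uses realizers of reflexivity and transitivity of ⊆, obtained by self-application. The converse
-- holds because r(β+1) contains r(β) as a subset and also (r(β), π) for every stack π
-- (`realizes_succ_mpr`). The witness for β+1 is r(β+1) itself, and the claim on n follows by
-- induction with witnesses r(k).
--
-- Quantifiers range over names in V, so r(α) ∈ V is also needed (`reish_mem_N`). The set of stacks
-- lies in V because it can be read off the preorder, and the recursion defining r is carried out in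
-- V by replacement, with set approximations to r.

theorem subst_rename : ∀ {n m k : ℕ} (g : Fin m → Term A B k) (f : Fin n → Fin m)
    (t : Term A B n), subst g (rename f t) = subst (fun i => g (f i)) t
  | _, _, _, g, f, var i => by simp [subst, rename]
  | _, _, _, g, f, app t s => by
      simp only [subst, rename, subst_rename g f t, subst_rename g f s]
  | _, _, _, g, f, lam t => by
      simp only [subst, rename, subst_rename _ _ t]
      congr 2
      funext i
      cases i using Fin.cases <;> simp
  | _, _, _, g, f, cc => by simp [subst, rename]
  | _, _, _, g, f, cont π => by simp [subst, rename]
  | _, _, _, g, f, instr a => by simp [subst, rename]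

theorem rename_rename : ∀ {n m k : ℕ} (g : Fin m → Fin k) (f : Fin n → Fin m)
    (t : Term A B n), rename g (rename f t) = rename (fun i => g (f i)) t
  | _, _, _, g, f, var i => by simp [rename]
  | _, _, _, g, f, app t s => by
      simp only [rename, rename_rename g f t, rename_rename g f s]
  | _, _, _, g, f, lam t => by
      simp only [rename, rename_rename _ _ t]
      congr 2
      funext i
      cases i using Fin.cases <;> simp
  | _, _, _, g, f, cc => by simp [rename]
  | _, _, _, g, f, cont π => by simp [rename]
  | _, _, _, g, f, instr a => by simp [rename]

theorem rename_subst : ∀ {n m k : ℕ} (g : Fin m → Fin k) (f : Fin n → Term A B m)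
    (t : Term A B n), rename g (subst f t) = subst (fun i => rename g (f i)) t
  | _, _, _, g, f, var i => by simp [subst]
  | _, _, _, g, f, app t s => by
      simp only [subst, rename, rename_subst g f t, rename_subst g f s]
  | _, _, _, g, f, lam t => by
      simp only [subst, rename, rename_subst _ _ t]
      congr 2
      funext i
      cases i using Fin.cases <;> simp [rename, rename_rename]
  | _, _, _, g, f, cc => by simp [subst, rename]
  | _, _, _, g, f, cont π => by simp [subst, rename]
  | _, _, _, g, f, instr a => by simp [subst, rename]

theorem subst_subst : ∀ {n m k : ℕ} (g : Fin m → Term A B k) (f : Fin n → Term A B m)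
    (t : Term A B n), subst g (subst f t) = subst (fun i => subst g (f i)) t
  | _, _, _, g, f, var i => by simp [subst]
  | _, _, _, g, f, app t s => by
      simp only [subst, subst_subst g f t, subst_subst g f s]
  | _, _, _, g, f, lam t => by
      simp only [subst, subst_subst _ _ t]
      congr 2
      funext i
      cases i using Fin.cases <;> simp [subst, subst_rename, rename_subst]
  | _, _, _, g, f, cc => by simp [subst]
  | _, _, _, g, f, cont π => by simp [subst]
  | _, _, _, g, f, instr a => by simp [subst]

theorem subst_var : ∀ {n : ℕ} (t : Term A B n), subst var t = t
  | _, var i => by simp [subst]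
  | _, app t s => by simp only [subst, subst_var t, subst_var s]
  | n, lam t => by
      have : (Fin.cases (var 0) fun i => rename Fin.succ (var i) :
          Fin (n + 1) → Term A B (n + 1)) = var := by
        funext i
        cases i using Fin.cases <;> simp [rename]
      simp only [subst, this, subst_var t]
  | _, cc => by simp [subst]
  | _, cont π => by simp [subst]
  | _, instr a => by simp [subst]

theorem noCont_rename : ∀ {n m : ℕ} (f : Fin n → Fin m) (t : Term A B n),
    NoCont (rename f t) ↔ NoCont t
  | _, _, f, var i => by simp [NoCont, rename]
  | _, _, f, app t s => by simp only [NoCont, rename, noCont_rename f t, noCont_rename f s]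
  | _, _, f, lam t => by simp only [NoCont, rename, noCont_rename _ t]
  | _, _, f, cc => by simp [NoCont, rename]
  | _, _, f, cont π => by simp [NoCont, rename]
  | _, _, f, instr a => by simp [NoCont, rename]

theorem subst_closed (f : Fin 0 → Term A B 0) (t : Term A B 0) : subst f t = t := by
  rw [Subsingleton.elim f var, subst_var]

/-- A closed term as a term in any number of variables. -/
def weaken {n : ℕ} (t : Term A B 0) : Term A B n := rename Fin.elim0 t

theorem subst_weaken {n : ℕ} (f : Fin n → Term A B 0) (t : Term A B 0) :
    subst f (weaken t) = t := by
  rw [weaken, subst_rename, subst_closed]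

theorem noCont_weaken {n : ℕ} (t : Term A B 0) : NoCont (weaken t : Term A B n) ↔ NoCont t :=
  noCont_rename _ _

/-- Realizers are run as an open body together with an environment `f` of closed terms. Grabbing an
argument then only extends the environment, and substitutions need not be computed. -/
theorem inst_subst {n : ℕ} (f : Fin n → Term A B 0) (t : Term A B (n + 1)) (s : Term A B 0) :
    inst (subst (Fin.cases (var 0) fun i => rename Fin.succ (f i)) t) s =
      subst (Matrix.vecCons s f) t := by
  rw [inst, subst_subst]
  congr 1
  funext i
  cases i using Fin.cases with
  | zero => simp [subst]
  | succ i => simp [subst_rename, subst_closed]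

end Term

namespace RealizabilityAlgebra

open Term

variable {V : Set ZFSet.{u}} (𝒜 : RealizabilityAlgebra V)

/-! ## Evaluation into the pole -/

theorem app_mem_pole {t s : 𝒜.Tm} {π : 𝒜.Stk} (h : (t, Stack.push s π) ∈ 𝒜.pole) :
    (app t s, π) ∈ 𝒜.pole :=
  𝒜.pole_closed _ _ (𝒜.red_of_step _ _ (.push _ _ _)) h

theorem subst_app_mem_pole {n : ℕ} {f : Fin n → 𝒜.Tm} {t s : Term (Elts 𝒜.A) (Elts 𝒜.B) n}
    {π : 𝒜.Stk} (h : (subst f t, Stack.push (subst f s) π) ∈ 𝒜.pole) :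
    (subst f (app t s), π) ∈ 𝒜.pole := by
  rw [subst]
  exact 𝒜.app_mem_pole h

theorem subst_lam_mem_pole {n : ℕ} {f : Fin n → 𝒜.Tm}
    {t : Term (Elts 𝒜.A) (Elts 𝒜.B) (n + 1)} {s : 𝒜.Tm}
    {π : 𝒜.Stk} (h : (subst (Matrix.vecCons s f) t, π) ∈ 𝒜.pole) :
    (subst f (lam t), Stack.push s π) ∈ 𝒜.pole := by
  rw [subst]
  refine 𝒜.pole_closed _ _ (𝒜.red_of_step _ _ (.grab _ _ _)) ?_
  rwa [inst_subst]

theorem lam_mem_pole {t : Term (Elts 𝒜.A) (Elts 𝒜.B) 1} {s : 𝒜.Tm}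
    {π : 𝒜.Stk} (h : (subst ![s] t, π) ∈ 𝒜.pole) :
    (lam t, Stack.push s π) ∈ 𝒜.pole := by
  have := 𝒜.subst_lam_mem_pole (f := ![]) h
  rwa [subst_closed] at this

theorem orth_anti {S T : Set 𝒜.Stk} (h : S ⊆ T) : 𝒜.orth T ⊆ 𝒜.orth S :=
  fun _ ht _ hπ => ht _ (h hπ)

/-! ## The falsity values of the atomic formulas -/

theorem mem_falNotMem {a b : ZFSet.{u}} {ρ : 𝒜.Stk} :
    ρ ∈ 𝒜.falNotMem a b ↔ ∃ (c : ZFSet.{u}) (π : 𝒜.Stk) (t t' : 𝒜.Tm),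
      ZFSet.pair c (codeS π) ∈ b ∧ ρ = Stack.push t (Stack.push t' π) ∧
      t ∈ 𝒜.orth (𝒜.falSubset a c) ∧ t' ∈ 𝒜.orth (𝒜.falSubset c a) := by
  rw [falNotMem]
  constructor
  · rintro ⟨c, π, h, t, t', h'⟩
    exact ⟨c, π, t, t', h, h'⟩
  · rintro ⟨c, π, t, t', h, h'⟩
    exact ⟨c, π, h, t, t', h'⟩

theorem mem_falSubset {a b : ZFSet.{u}} {ρ : 𝒜.Stk} :
    ρ ∈ 𝒜.falSubset a b ↔ ∃ (c : ZFSet.{u}) (π : 𝒜.Stk) (t : 𝒜.Tm),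
      ZFSet.pair c (codeS π) ∈ a ∧ ρ = Stack.push t π ∧ t ∈ 𝒜.orth (𝒜.falNotMem c b) := by
  rw [falSubset]
  constructor
  · rintro ⟨c, π, h, t, h'⟩
    exact ⟨c, π, t, h, h'⟩
  · rintro ⟨c, π, t, h, h'⟩
    exact ⟨c, π, h, t, h'⟩

theorem orth_falNotMem {a b : ZFSet.{u}} {t : 𝒜.Tm} :
    t ∈ 𝒜.orth (𝒜.falNotMem a b) ↔ ∀ (c : ZFSet.{u}) (π : 𝒜.Stk) (s s' : 𝒜.Tm),
      ZFSet.pair c (codeS π) ∈ b → s ∈ 𝒜.orth (𝒜.falSubset a c) →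
      s' ∈ 𝒜.orth (𝒜.falSubset c a) → (t, Stack.push s (Stack.push s' π)) ∈ 𝒜.pole := by
  constructor
  · intro h c π s s' hc hs hs'
    exact h _ (𝒜.mem_falNotMem.2 ⟨c, π, s, s', hc, rfl, hs, hs'⟩)
  · intro h ρ hρ
    obtain ⟨c, π, s, s', hc, rfl, hs, hs'⟩ := 𝒜.mem_falNotMem.1 hρ
    exact h c π s s' hc hs hs'

theorem orth_falSubset {a b : ZFSet.{u}} {t : 𝒜.Tm} :
    t ∈ 𝒜.orth (𝒜.falSubset a b) ↔ ∀ (c : ZFSet.{u}) (π : 𝒜.Stk) (s : 𝒜.Tm),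
      ZFSet.pair c (codeS π) ∈ a → s ∈ 𝒜.orth (𝒜.falNotMem c b) →
      (t, Stack.push s π) ∈ 𝒜.pole := by
  constructor
  · intro h c π s hc hs
    exact h _ (𝒜.mem_falSubset.2 ⟨c, π, s, hc, rfl, hs⟩)
  · intro h ρ hρ
    obtain ⟨c, π, s, hc, rfl, hs⟩ := 𝒜.mem_falSubset.1 hρ
    exact h c π s hc hs

/-- Set inclusion between names carries realizers over unchanged, at no computational cost. This
keeps the realizers below independent of the ordinals involved. -/
theorem falNotMem_mono {a b b' : ZFSet.{u}} (h : b ⊆ b') :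
    𝒜.falNotMem a b ⊆ 𝒜.falNotMem a b' := by
  intro ρ hρ
  obtain ⟨c, π, s, s', hc, h'⟩ := 𝒜.mem_falNotMem.1 hρ
  exact 𝒜.mem_falNotMem.2 ⟨c, π, s, s', h hc, h'⟩

theorem falSubset_anti {a b b' : ZFSet.{u}} (h : b ⊆ b') :
    𝒜.falSubset a b' ⊆ 𝒜.falSubset a b := by
  intro ρ hρ
  obtain ⟨c, π, s, hc, rfl, hs⟩ := 𝒜.mem_falSubset.1 hρ
  exact 𝒜.mem_falSubset.2 ⟨c, π, s, hc, rfl, 𝒜.orth_anti (𝒜.falNotMem_mono h) hs⟩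

theorem orth_imp {n : ℕ} {φ ψ : Fml n} {v : Fin n → ZFSet.{u}} {t : 𝒜.Tm} :
    𝒜.Realizes t (φ.imp ψ) v ↔
      ∀ s π, 𝒜.Realizes s φ v → π ∈ 𝒜.falsity ψ v → (t, Stack.push s π) ∈ 𝒜.pole := by
  constructor
  · intro h s π hs hπ
    exact h _ (by rw [falsity]; exact ⟨s, π, rfl, hs, hπ⟩)
  · intro h ρ hρ
    rw [falsity] at hρ
    obtain ⟨s, π, rfl, hs, hπ⟩ := hρ
    exact h s π hs hπ

theorem realizes_neg {n : ℕ} {φ : Fml n} {v : Fin n → ZFSet.{u}} {t : 𝒜.Tm} :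
    𝒜.Realizes t (φ.imp Fml.bot) v ↔
      ∀ s π, 𝒜.Realizes s φ v → (t, Stack.push s π) ∈ 𝒜.pole := by
  rw [orth_imp]
  simp [falsity]

theorem realizes_all {n : ℕ} {φ : Fml (n + 1)} {v : Fin n → ZFSet.{u}} {t : 𝒜.Tm} :
    𝒜.Realizes t φ.all v ↔ ∀ a ∈ 𝒜.N, 𝒜.Realizes t φ (Fin.cons a v) := by
  constructor
  · intro h a ha π hπ
    exact h _ (by rw [falsity]; exact ⟨a, ha, hπ⟩)
  · intro h ρ hρ
    rw [falsity] at hρ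
    obtain ⟨a, ha, hπ⟩ := hρ
    exact h a ha _ hπ

theorem realizes_subset {n : ℕ} {i j : Fin n} {v : Fin n → ZFSet.{u}} {t : 𝒜.Tm} :
    𝒜.Realizes t (.subset i j) v ↔ t ∈ 𝒜.orth (𝒜.falSubset (v i) (v j)) := by
  rw [Realizes, falsity]

theorem realizes_notMem {n : ℕ} {i j : Fin n} {v : Fin n → ZFSet.{u}} {t : 𝒜.Tm} :
    𝒜.Realizes t (.notMem i j) v ↔ t ∈ 𝒜.orth (𝒜.falNotMem (v i) (v j)) := by
  rw [Realizes, falsity]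

/-! ## Realizers for conjunctions and existential formulas -/

/-- `λ f. f t s`. -/
def pairTm (t s : 𝒜.Tm) : 𝒜.Tm := lam (app (app (var 0) (weaken t)) (weaken s))

theorem noCont_pairTm {t s : 𝒜.Tm} (ht : t.NoCont) (hs : s.NoCont) : (𝒜.pairTm t s).NoCont := by
  simp [pairTm, NoCont, noCont_weaken, ht, hs]

theorem realizes_and {n : ℕ} {φ ψ : Fml n} {v : Fin n → ZFSet.{u}} {t s : 𝒜.Tm}
    (ht : 𝒜.Realizes t φ v) (hs : 𝒜.Realizes s ψ v) :
    𝒜.Realizes (𝒜.pairTm t s) (φ.and ψ) v := by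
  rw [Fml.and, realizes_neg]
  intro f π hf
  rw [pairTm]
  refine 𝒜.lam_mem_pole (𝒜.subst_app_mem_pole (𝒜.subst_app_mem_pole ?_))
  simp only [subst_weaken]
  refine 𝒜.orth_imp.1 hf _ _ ht ?_
  rw [falsity]
  exact ⟨s, π, rfl, hs, by simp [falsity]⟩

/-- `λ g. g t`. -/
def wrapTm (t : 𝒜.Tm) : 𝒜.Tm := lam (app (var 0) (weaken t))

theorem noCont_wrapTm {t : 𝒜.Tm} (ht : t.NoCont) : (𝒜.wrapTm t).NoCont := by
  simp [wrapTm, NoCont, noCont_weaken, ht]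

theorem realizes_ex {n : ℕ} {φ : Fml (n + 1)} {v : Fin n → ZFSet.{u}} {t : 𝒜.Tm}
    {a : ZFSet.{u}} (ha : a ∈ 𝒜.N) (ht : 𝒜.Realizes t φ (Fin.cons a v)) :
    𝒜.Realizes (𝒜.wrapTm t) φ.ex v := by
  rw [Fml.ex, realizes_neg]
  intro g π hg
  refine 𝒜.lam_mem_pole (𝒜.subst_app_mem_pole ?_)
  rw [subst_weaken]
  exact 𝒜.realizes_neg.1 (𝒜.realizes_all.1 hg a ha) t π ht

/-! ## Reflexivity and transitivity of inclusion -/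

/-- The self-application of `λ w t. t (w w) (w w)`. -/
def reflTm : 𝒜.Tm :=
  app (lam (lam (app (app (var 0) (app (var 1) (var 1))) (app (var 1) (var 1)))))
    (lam (lam (app (app (var 0) (app (var 1) (var 1))) (app (var 1) (var 1)))))

theorem noCont_reflTm : 𝒜.reflTm.NoCont := by
  simp [reflTm, NoCont]

theorem reflTm_eval {t : 𝒜.Tm} {π : 𝒜.Stk}
    (h : (t, Stack.push 𝒜.reflTm (Stack.push 𝒜.reflTm π)) ∈ 𝒜.pole) :
    (𝒜.reflTm, Stack.push t π) ∈ 𝒜.pole :=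
  𝒜.app_mem_pole <| 𝒜.lam_mem_pole <| 𝒜.subst_lam_mem_pole <| 𝒜.subst_app_mem_pole <|
    𝒜.subst_app_mem_pole <| by simpa [subst, reflTm] using h

/-- If (c, π) ∈ a and `s` realizes c ∉ a, then `s` meets π once it is given two realizers of c ⊆ c.
By induction on the rank, `reflTm` serves as both. -/
theorem reflTm_mem_self (a : ZFSet.{u}) : 𝒜.reflTm ∈ 𝒜.orth (𝒜.falSubset a a) := by
  suffices H : ∀ o (a : ZFSet.{u}), a.rank = o → 𝒜.reflTm ∈ 𝒜.orth (𝒜.falSubset a a) from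
    H _ a rfl
  intro o
  induction o using WellFoundedLT.induction with
  | ind o ih =>
    rintro a rfl
    rw [orth_falSubset]
    intro c π s hc hs
    have hr := ih _ (rank_lt_of_pair_mem hc) c rfl
    exact 𝒜.reflTm_eval (𝒜.orth_falNotMem.1 hs c π _ _ hc hr hr)

/-- `λ w p q s. p (λ u u'. q (λ y y'. s (w w u y) (w w y' u')))`. -/
def transAux : 𝒜.Tm :=
  lam (lam (lam (lam (app (var 2) (lam (lam (app (var 3) (lam (lam
    (app (app (var 4) (app (app (app (var 7) (var 7)) (var 3)) (var 1)))
      (app (app (app (var 7) (var 7)) (var 0)) (var 2))))))))))))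

/-- The term with `transTm p q s = p (λ u u'. q (λ y y'. s (transTm u y) (transTm y' u')))`. -/
def transTm : 𝒜.Tm := app 𝒜.transAux 𝒜.transAux

theorem noCont_transTm : 𝒜.transTm.NoCont := by
  simp [transTm, transAux, NoCont]

/-- An element x of a has some y ≃ x in b by `p`, and y has some w ≃ y in c by `q`. Then x ≃ w by
transitivity at lower rank, against x ∉ c. -/
theorem transTm_mem {a b c : ZFSet.{u}} {p q : 𝒜.Tm} (hp : p ∈ 𝒜.orth (𝒜.falSubset a b))
    (hq : q ∈ 𝒜.orth (𝒜.falSubset b c)) :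
    app (app 𝒜.transTm p) q ∈ 𝒜.orth (𝒜.falSubset a c) := by
  -- The recursive calls go along x, y, w and back along w, y, x, so the measure has to be
  -- symmetric: a common bound of the three ranks.
  suffices H : ∀ o (a b c : ZFSet.{u}), a.rank ≤ o → b.rank ≤ o → c.rank ≤ o →
      ∀ p ∈ 𝒜.orth (𝒜.falSubset a b), ∀ q ∈ 𝒜.orth (𝒜.falSubset b c),
      app (app 𝒜.transTm p) q ∈ 𝒜.orth (𝒜.falSubset a c) from
    H (max a.rank (max b.rank c.rank)) a b c (by simp) (by simp) (by simp) p hp q hq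
  intro o
  induction o using WellFoundedLT.induction with
  | ind o ih =>
    intro a b c ha hb hc p hp q hq
    rw [orth_falSubset]
    intro x π s hx hs
    refine 𝒜.app_mem_pole <| 𝒜.app_mem_pole <| 𝒜.app_mem_pole <| 𝒜.lam_mem_pole <|
      𝒜.subst_lam_mem_pole <| 𝒜.subst_lam_mem_pole <| 𝒜.subst_lam_mem_pole <|
      𝒜.subst_app_mem_pole ?_
    -- The head is variable 2 in the environment s, q, p, `transAux`; it unfolds to `p` by
    -- definition, hence the explicit `t`.
    refine (𝒜.orth_falSubset (t := p)).1 hp x π _ hx ?_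
    rw [orth_falNotMem]
    intro y π' u u' hy hu hu'
    refine 𝒜.subst_lam_mem_pole <| 𝒜.subst_lam_mem_pole <| 𝒜.subst_app_mem_pole ?_
    refine (𝒜.orth_falSubset (t := q)).1 hq y π' _ hy ?_
    rw [orth_falNotMem]
    intro w π'' r r' hw hr hr'
    refine 𝒜.subst_lam_mem_pole <| 𝒜.subst_lam_mem_pole <| 𝒜.subst_app_mem_pole <|
      𝒜.subst_app_mem_pole ?_
    have hx' := (rank_lt_of_pair_mem hx).trans_le ha
    have hy' := (rank_lt_of_pair_mem hy).trans_le hb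
    have hw' := (rank_lt_of_pair_mem hw).trans_le hc
    have h1 := ih (max x.rank (max y.rank w.rank)) (by simp [hx', hy', hw']) x y w
      (by simp) (by simp) (by simp) u hu r hr
    have h2 := ih (max x.rank (max y.rank w.rank)) (by simp [hx', hy', hw']) w y x
      (by simp) (by simp) (by simp) r' hr' u' hu'
    exact 𝒜.orth_falNotMem.1 hs w π'' _ _ hw h1 h2

/-! ## Recursive names -/

/-- Every stack is paired with every r(y), so π is irrelevant here and injectivity of `codeS` is not
needed. -/
theorem pair_mem_reish {x c : ZFSet.{u}} {π : 𝒜.Stk} :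
    ZFSet.pair c (codeS π) ∈ 𝒜.reish x ↔ ∃ y ∈ x, c = 𝒜.reish y := by
  rw [reish]
  simp only [ZFSet.mem_range]
  constructor
  · rintro ⟨p, hp⟩
    exact ⟨_, p.1.2, (ZFSet.pair_injective hp).1.symm⟩
  · rintro ⟨y, hy, rfl⟩
    exact ⟨(⟨y, hy⟩, π), rfl⟩

theorem mem_reish {x z : ZFSet.{u}} :
    z ∈ 𝒜.reish x ↔ ∃ y ∈ x, ∃ π : 𝒜.Stk, z = ZFSet.pair (𝒜.reish y) (codeS π) := by
  rw [reish]
  simp only [ZFSet.mem_range]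
  constructor
  · rintro ⟨p, rfl⟩
    exact ⟨_, p.1.2, p.2, rfl⟩
  · rintro ⟨y, hy, π, rfl⟩
    exact ⟨(⟨y, hy⟩, π), rfl⟩

theorem reish_mono {x y : ZFSet.{u}} (h : x ⊆ y) : 𝒜.reish x ⊆ 𝒜.reish y := by
  intro z hz
  obtain ⟨w, hw, π, rfl⟩ := 𝒜.mem_reish.1 hz
  exact 𝒜.mem_reish.2 ⟨w, h hw, π, rfl⟩

theorem isName_reish (x : ZFSet.{u}) : 𝒜.IsName (𝒜.reish x) := by
  induction x using ZFSet.inductionOn with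
  | _ x ih =>
    refine .mk _ ?_ ?_
    · intro z hz
      obtain ⟨y, -, π, rfl⟩ := 𝒜.mem_reish.1 hz
      exact ⟨_, _, rfl⟩
    · intro c π hc
      obtain ⟨y, hy, rfl⟩ := 𝒜.pair_mem_reish.1 hc
      exact ih y hy

/-- `λ w t u. t (w w u) (w w t)`. -/
def compareAux : 𝒜.Tm :=
  lam (lam (lam (app (app (var 1) (app (app (var 2) (var 2)) (var 0)))
    (app (app (var 2) (var 2)) (var 1)))))

/-- The term with `compareTm t u = t (compareTm u) (compareTm t)`. -/
def compareTm : 𝒜.Tm := app 𝒜.compareAux 𝒜.compareAux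

theorem noCont_compareTm : 𝒜.compareTm.NoCont := by
  simp [compareTm, compareAux, NoCont]

theorem compareTm_eval {t s : 𝒜.Tm} {π : 𝒜.Stk}
    (h : (t, Stack.push (app 𝒜.compareTm s) (Stack.push (app 𝒜.compareTm t) π)) ∈ 𝒜.pole) :
    (app 𝒜.compareTm t, Stack.push s π) ∈ 𝒜.pole :=
  𝒜.app_mem_pole <| 𝒜.app_mem_pole <| 𝒜.lam_mem_pole <| 𝒜.subst_lam_mem_pole <|
    𝒜.subst_lam_mem_pole <| 𝒜.subst_app_mem_pole <| 𝒜.subst_app_mem_pole h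

/-- Comparability of recursive names of ordinals, in the form `r(y) ∉ r(x) → r(x) ⊆ r(y)`. -/
theorem compareTm_mem {x y : ZFSet.{u}} (hx : x.IsOrdinal) (hy : y.IsOrdinal) {t : 𝒜.Tm}
    (ht : t ∈ 𝒜.orth (𝒜.falNotMem (𝒜.reish y) (𝒜.reish x))) :
    app 𝒜.compareTm t ∈ 𝒜.orth (𝒜.falSubset (𝒜.reish x) (𝒜.reish y)) := by
  let P (x y : ZFSet.{u}) : Prop := ∀ t ∈ 𝒜.orth (𝒜.falNotMem (𝒜.reish y) (𝒜.reish x)),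
    app 𝒜.compareTm t ∈ 𝒜.orth (𝒜.falSubset (𝒜.reish x) (𝒜.reish y))
  -- For z ∈ x and `s` realizing r(z) ∉ r(y), the term `t` refutes r(y) ≃ r(z). The two inclusions
  -- come from P y z applied to `s` and from P z y applied to `t` again, since r(z) ⊆ r(x) by
  -- transitivity of x.
  have step (x y : ZFSet.{u}) (hx : x.IsOrdinal) (h : ∀ z ∈ x, P z y ∧ P y z) : P x y := by
    intro t ht
    rw [orth_falSubset]
    intro c π s hc hs
    obtain ⟨z, hz, rfl⟩ := 𝒜.pair_mem_reish.1 hc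
    refine 𝒜.compareTm_eval (𝒜.orth_falNotMem.1 ht _ _ _ _ hc ((h z hz).2 s hs)
      ((h z hz).1 t (𝒜.orth_anti (𝒜.falNotMem_mono (𝒜.reish_mono ?_)) ht)))
    exact hx.isTransitive.subset_of_mem hz
  suffices H : ∀ x : ZFSet.{u}, x.IsOrdinal → ∀ y : ZFSet.{u}, y.IsOrdinal → P x y ∧ P y x from
    (H x hx y hy).1 t ht
  intro x
  induction x using ZFSet.inductionOn with
  | _ x ihx =>
    intro hx y
    induction y using ZFSet.inductionOn with
    | _ y ihy =>
      intro hy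
      -- One step descends in x and the other in y, and each needs both directions at the smaller
      -- pair; hence the conjunction and the nested induction.
      exact ⟨step x y hx fun z hz => ihx z hz (hx.mem hz) y hy,
        step y x hy fun z hz => (ihy z hz (hy.mem hz)).symm⟩

/-! ## Successors -/

/-- `λ a b c. a (λ p p'. b (λ t. c (λ k. k p
(transTm (compareTm (λ e e'. t (transTm p e) (transTm e' p'))) p'))))`. -/
def succMpTm : 𝒜.Tm :=
  lam (lam (lam (app (var 2) (lam (lam (app (var 3) (lam (app (var 3) (lam
    (app (app (var 0) (var 3)) (app (app (weaken 𝒜.transTm) (app (weaken 𝒜.compareTm) (lam (lam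
      (app (app (var 3) (app (app (weaken 𝒜.transTm) (var 5)) (var 1)))
        (app (app (weaken 𝒜.transTm) (var 0)) (var 4))))))) (var 2))))))))))))

theorem noCont_succMpTm : 𝒜.succMpTm.NoCont := by
  simp [succMpTm, NoCont, noCont_weaken, noCont_transTm, noCont_compareTm]

theorem realizes_succ_mp {n : ℕ} {i j k : Fin n} {v : Fin n → ZFSet.{u}} {β : ZFSet.{u}}
    (hβ : β.IsOrdinal) (hi : v i = 𝒜.reish (insert β β)) (hj : v j = 𝒜.reish β) :
    𝒜.Realizes 𝒜.succMpTm (.imp (.mem k i) (.or (.mem k j) (.simeq k j))) v := by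
  rw [orth_imp]
  intro a ρ ha hρ
  rw [Fml.or, falsity] at hρ
  obtain ⟨b, ρ, rfl, hb, hρ⟩ := hρ
  rw [falsity] at hρ
  obtain ⟨c, ρ, rfl, hc, -⟩ := hρ
  change 𝒜.Realizes b _ v at hb
  change 𝒜.Realizes c _ v at hc
  refine 𝒜.lam_mem_pole <| 𝒜.subst_lam_mem_pole <| 𝒜.subst_lam_mem_pole <|
    𝒜.subst_app_mem_pole ?_
  refine (𝒜.realizes_neg (t := a)).1 ha _ _ ?_
  rw [realizes_notMem, orth_falNotMem, hi]
  intro d π p p' hd hp hp'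
  obtain ⟨γ, hγ, rfl⟩ := 𝒜.pair_mem_reish.1 hd
  -- Only γ ⊆ β is retained, so the cases γ = β and γ ∈ β are served by the same realizer.
  have hγo : γ.IsOrdinal ∧ γ ⊆ β := by
    rcases ZFSet.mem_insert_iff.1 hγ with rfl | hγ
    · exact ⟨hβ, fun _ h => h⟩
    · exact ⟨hβ.mem hγ, hβ.isTransitive.subset_of_mem hγ⟩
  refine 𝒜.subst_lam_mem_pole <| 𝒜.subst_lam_mem_pole <| 𝒜.subst_app_mem_pole ?_
  -- Since `b` refutes z ∈ r(β), where z is `v k`, it suffices to hand it a proof of z ∈ r(β). That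
  -- proof receives `t`, a realizer of z ∉ r(β), and escapes through `c` by showing z ≃ r(β).
  refine (𝒜.realizes_neg (t := b)).1 hb _ _ ?_
  rw [Fml.mem, Fml.neg, realizes_neg]
  intro t π' ht
  rw [realizes_notMem, hj, orth_falNotMem] at ht
  refine 𝒜.subst_lam_mem_pole <| 𝒜.subst_app_mem_pole ?_
  refine (𝒜.realizes_neg (t := c)).1 hc _ _ ?_
  rw [Fml.simeq, Fml.and, realizes_neg]
  intro f π'' hf
  refine 𝒜.subst_lam_mem_pole <| 𝒜.subst_app_mem_pole <| 𝒜.subst_app_mem_pole ?_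
  simp only [subst.eq_2, subst_weaken]
  refine (𝒜.orth_imp (t := f)).1 hf p _ ?_ ?_
  · rw [realizes_subset, hj]
    exact 𝒜.orth_anti (𝒜.falSubset_anti (𝒜.reish_mono hγo.2)) hp
  rw [falsity]
  refine ⟨_, _, rfl, ?_, by simp [falsity]⟩
  rw [falsity, hj]
  -- This is r(β) ⊆ r(γ) ⊆ z. What remains is r(γ) ∉ r(β): any d ≃ r(γ) in r(β) would satisfy d ≃ z,
  -- which `t` refutes.
  refine 𝒜.transTm_mem (𝒜.compareTm_mem hβ hγo.1 ?_) hp'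
  rw [orth_falNotMem]
  intro d π₁ e e' hd he he'
  refine 𝒜.subst_lam_mem_pole <| 𝒜.subst_lam_mem_pole <| 𝒜.subst_app_mem_pole <|
    𝒜.subst_app_mem_pole ?_
  simp only [subst.eq_2, subst_weaken]
  exact ht d π₁ _ _ hd (𝒜.transTm_mem hp he) (𝒜.transTm_mem he' hp')

/-- `λ o s. o (λ m. m s) (λ m. m s)`. -/
def succMprTm : 𝒜.Tm :=
  lam (lam (app (app (var 1) (lam (app (var 0) (var 1)))) (lam (app (var 0) (var 1)))))

theorem noCont_succMprTm : 𝒜.succMprTm.NoCont := by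
  simp [succMprTm, NoCont]

/-- A realizer `s` of z ∉ r(β+1) is, unchanged, a realizer of z ∉ r(β), and it also refutes the two
inclusions of z ≃ r(β), as r(β) occurs in r(β+1) with every stack. Hence both branches are the same
term. -/
theorem realizes_succ_mpr {n : ℕ} {i j k : Fin n} {v : Fin n → ZFSet.{u}} {β : ZFSet.{u}}
    (hi : v i = 𝒜.reish (insert β β)) (hj : v j = 𝒜.reish β) :
    𝒜.Realizes 𝒜.succMprTm (.imp (.or (.mem k j) (.simeq k j)) (.mem k i)) v := by
  rw [orth_imp]
  intro o ρ ho hρ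
  rw [Fml.mem, Fml.neg, falsity] at hρ
  obtain ⟨s, π, rfl, hs, -⟩ := hρ
  change 𝒜.Realizes s _ v at hs
  rw [realizes_notMem, hi] at hs
  refine 𝒜.lam_mem_pole <| 𝒜.subst_lam_mem_pole <| 𝒜.subst_app_mem_pole <|
    𝒜.subst_app_mem_pole ?_
  refine (𝒜.orth_imp (t := o)).1 ho _ _ ?_ ?_
  · rw [realizes_neg]
    intro m π' hm
    refine 𝒜.subst_lam_mem_pole <| 𝒜.subst_app_mem_pole ?_
    refine (𝒜.realizes_neg (t := m)).1 hm s _ ?_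
    rw [realizes_notMem, hj]
    exact 𝒜.orth_anti (𝒜.falNotMem_mono (𝒜.reish_mono fun _ h => ZFSet.mem_insert_of_mem _ h)) hs
  · rw [falsity]
    refine ⟨_, _, rfl, ?_, by simp [falsity]⟩
    change 𝒜.Realizes _ _ v
    rw [realizes_neg]
    intro m π' hm
    refine 𝒜.subst_lam_mem_pole <| 𝒜.subst_app_mem_pole ?_
    refine (𝒜.realizes_neg (t := m)).1 hm s _ ?_
    rw [orth_imp]
    intro p ρ hp hρ
    rw [falsity] at hρ
    obtain ⟨p', π'', rfl, hp', -⟩ := hρ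
    change 𝒜.Realizes p' _ v at hp'
    rw [realizes_subset, hj] at hp hp'
    exact 𝒜.orth_falNotMem.1 hs _ _ _ _
      (𝒜.pair_mem_reish.2 ⟨β, ZFSet.mem_insert _ _, rfl⟩) hp hp'

/-- The realizer of the successor formula. -/
def succTm : 𝒜.Tm := 𝒜.pairTm 𝒜.succMpTm 𝒜.succMprTm

theorem noCont_succTm : 𝒜.succTm.NoCont :=
  𝒜.noCont_pairTm 𝒜.noCont_succMpTm 𝒜.noCont_succMprTm

theorem realizes_isSucc {n : ℕ} {i j : Fin n} {v : Fin n → ZFSet.{u}} {β : ZFSet.{u}}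
    (hβ : β.IsOrdinal) (hi : v i = 𝒜.reish (insert β β)) (hj : v j = 𝒜.reish β) :
    𝒜.Realizes 𝒜.succTm (.isSucc i j) v := by
  rw [Fml.isSucc, realizes_all]
  intro z _
  exact 𝒜.realizes_and (𝒜.realizes_succ_mp hβ (by simpa using hi) (by simpa using hj))
    (𝒜.realizes_succ_mpr (by simpa using hi) (by simpa using hj))

/-- The realizer of the formula `x ≃ y + 1`. -/
def simeqSuccTm : 𝒜.Tm := 𝒜.wrapTm (𝒜.pairTm 𝒜.succTm (𝒜.pairTm 𝒜.reflTm 𝒜.reflTm))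

theorem noCont_simeqSuccTm : 𝒜.simeqSuccTm.NoCont :=
  𝒜.noCont_wrapTm (𝒜.noCont_pairTm 𝒜.noCont_succTm
    (𝒜.noCont_pairTm 𝒜.noCont_reflTm 𝒜.noCont_reflTm))

theorem realizes_simeqSucc {n : ℕ} {i j : Fin n} {v : Fin n → ZFSet.{u}} {β : ZFSet.{u}}
    (hβ : β.IsOrdinal) (hN : 𝒜.reish (insert β β) ∈ 𝒜.N)
    (hi : v i = 𝒜.reish (insert β β)) (hj : v j = 𝒜.reish β) :
    𝒜.Realizes 𝒜.simeqSuccTm (.simeqSucc i j) v := by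
  refine 𝒜.realizes_ex hN (𝒜.realizes_and (𝒜.realizes_isSucc hβ ?_ ?_)
    (𝒜.realizes_and ?_ ?_))
  · simp
  · simpa using hj
  all_goals
    rw [realizes_subset]
    simpa [hi] using 𝒜.reflTm_mem_self _

theorem isOrdinal_finOrd (k : ℕ) : (finOrd.{u} k).IsOrdinal := by
  induction k with
  | zero => exact ZFSet.isOrdinal_empty
  | succ k ih =>
    rw [finOrd]
    refine ⟨fun x hx y hy => ?_, fun {x y z} hx hy hz => ?_⟩
    · rcases ZFSet.mem_insert_iff.1 hx with rfl | hx
      · exact ZFSet.mem_insert_of_mem _ hy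
      · exact ZFSet.mem_insert_of_mem _ (ih.isTransitive.mem_trans hy hx)
    · rcases ZFSet.mem_insert_iff.1 hz with rfl | hz
      · exact ih.mem_trans hx hy
      · exact (ih.mem hz).mem_trans hx hy

/-- The realizer of the formula saying that `x` is the `k`-th successor of the empty set. -/
def nthSuccTm : ℕ → 𝒜.Tm
  -- Any term without continuation constants would do: r(∅) is empty, so z ∉ r(∅) has empty falsity
  -- value.
  | 0 => Term.cc
  | k + 1 => 𝒜.wrapTm (𝒜.pairTm (nthSuccTm k) 𝒜.succTm)

theorem noCont_nthSuccTm (k : ℕ) : (𝒜.nthSuccTm k).NoCont := by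
  induction k with
  | zero => simp [nthSuccTm, NoCont]
  | succ k ih => exact 𝒜.noCont_wrapTm (𝒜.noCont_pairTm ih 𝒜.noCont_succTm)

theorem realizes_isNthSucc (hN : ∀ k, 𝒜.reish (finOrd k) ∈ 𝒜.N) (k : ℕ) :
    ∀ {n : ℕ} {i : Fin n} {v : Fin n → ZFSet.{u}}, v i = 𝒜.reish (finOrd k) →
    𝒜.Realizes (𝒜.nthSuccTm k) (.isNthSucc k i) v := by
  induction k with
  | zero =>
    intro n i v hv
    rw [Fml.isNthSucc, Fml.isEmpty, realizes_all]
    intro z _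
    rw [realizes_notMem, orth_falNotMem]
    intro c π s s' hc
    rw [Fin.cons_succ, hv, pair_mem_reish] at hc
    simp [finOrd] at hc
  | succ k ih =>
    intro n i v hv
    exact 𝒜.realizes_ex (hN k) (𝒜.realizes_and (ih rfl)
      (𝒜.realizes_isSucc (isOrdinal_finOrd k) hv rfl))

end RealizabilityAlgebra
end RealizabilityZF

namespace RealizabilityZF

/-! ## Definability in a class of sets -/

section Definability

open FirstOrder Language

/-- The structure of the class `V` with the membership relation. -/
@[reducible] def classStructure (V : Set ZFSet.{u}) : setLang.Structure V :=
  setStructure (fun x y : V => (x : ZFSet) ∈ (y : ZFSet))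

/-- `P` is definable with parameters in `(V, ∈)`. -/
def DefinablePred {V : Set ZFSet.{u}} {n : ℕ} (P : (Fin n → V) → Prop) : Prop :=
  letI := classStructure V
  (Set.univ : Set V).Definable setLang {v | P v}

/-- `f` is a variable or a parameter. -/
def IsTermFun {V : Set ZFSet.{u}} {n : ℕ} (f : (Fin n → V) → V) : Prop :=
  letI := classStructure V
  ∃ t : (setLang[[(Set.univ : Set V)]]).Term (Fin n), ∀ v, t.realize v = f v

variable {V : Set ZFSet.{u}} {n : ℕ}

theorem IsTermFun.coord (i : Fin n) : IsTermFun (fun v : Fin n → V => v i) :=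
  ⟨Language.Term.var i, fun _ => rfl⟩

theorem IsTermFun.const (c : V) : IsTermFun (fun _ : Fin n → V => c) := by
  let _ := classStructure V
  exact ⟨(setLang.con (⟨c, trivial⟩ : (Set.univ : Set V))).term, fun _ => by simp⟩

theorem IsTermFun.tail {f : (Fin n → V) → V} (hf : IsTermFun f) :
    IsTermFun (fun v : Fin (n + 1) → V => f (Fin.tail v)) := by
  let _ := classStructure V
  obtain ⟨t, ht⟩ := hf
  exact ⟨t.relabel Fin.succ, fun v => (Term.realize_relabel).trans (ht _)⟩

namespace DefinablePred

theorem mem {f g : (Fin n → V) → V} (hf : IsTermFun f) (hg : IsTermFun g) :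
    DefinablePred (fun v => (f v : ZFSet) ∈ (g v : ZFSet)) := by
  let _ := classStructure V
  obtain ⟨t, ht⟩ := hf
  obtain ⟨s, hs⟩ := hg
  refine ⟨Relations.formula₂ (L := setLang[[(Set.univ : Set V)]]) (Sum.inl SetRel.mem) t s, ?_⟩
  ext v
  refine Iff.trans ?_ Formula.realize_rel₂.symm
  rw [ht, hs]
  rfl

theorem eq {f g : (Fin n → V) → V} (hf : IsTermFun f) (hg : IsTermFun g) :
    DefinablePred (fun v => f v = g v) := by
  let _ := classStructure V
  obtain ⟨t, ht⟩ := hf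
  obtain ⟨s, hs⟩ := hg
  refine ⟨t.equal s, ?_⟩
  ext v
  simp [← ht, ← hs]

theorem and {P Q : (Fin n → V) → Prop} (hP : DefinablePred P) (hQ : DefinablePred Q) :
    DefinablePred (fun v => P v ∧ Q v) :=
  let _ := classStructure V
  Set.Definable.inter (L := setLang) hP hQ

theorem or {P Q : (Fin n → V) → Prop} (hP : DefinablePred P) (hQ : DefinablePred Q) :
    DefinablePred (fun v => P v ∨ Q v) :=
  let _ := classStructure V
  Set.Definable.union (L := setLang) hP hQ

theorem not {P : (Fin n → V) → Prop} (hP : DefinablePred P) :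
    DefinablePred (fun v => ¬ P v) :=
  let _ := classStructure V
  Set.Definable.compl (L := setLang) hP

theorem imp {P Q : (Fin n → V) → Prop} (hP : DefinablePred P) (hQ : DefinablePred Q) :
    DefinablePred (fun v => P v → Q v) := by
  simpa only [imp_iff_not_or] using hP.not.or hQ

theorem iff {P Q : (Fin n → V) → Prop} (hP : DefinablePred P) (hQ : DefinablePred Q) :
    DefinablePred (fun v => P v ↔ Q v) := by
  simpa only [iff_iff_implies_and_implies] using (hP.imp hQ).and (hQ.imp hP)

/-- Quantification is projection along `Fin.succ`. The bound variable is coordinate 0, so each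
quantifier crossed shifts the outer coordinates by one and costs one `tail`. -/
theorem ex {P : (Fin n → V) → V → Prop}
    (h : DefinablePred (fun w : Fin (n + 1) → V => P (Fin.tail w) (w 0))) :
    DefinablePred (fun v => ∃ x, P v x) := by
  let _ := classStructure V
  have := Set.Definable.image_comp (L := setLang) h Fin.succ
  refine (congr rfl (Set.ext fun v => ?_)).mp this
  constructor
  · rintro ⟨w, hw, rfl⟩
    exact ⟨w 0, hw⟩
  · rintro ⟨x, hx⟩
    exact ⟨Fin.cons x v, by simpa using hx, by funext i; simp⟩

theorem all {P : (Fin n → V) → V → Prop}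
    (h : DefinablePred (fun w : Fin (n + 1) → V => P (Fin.tail w) (w 0))) :
    DefinablePred (fun v => ∀ x, P v x) := by
  have := (ex (P := fun v x => ¬ P v x) h.not).not
  simpa only [not_exists, not_not] using this

end DefinablePred

end Definability

/-! ## Closure properties of transitive models -/

namespace IsTransitiveModelZF

variable {V : Set ZFSet.{u}} (hV : IsTransitiveModelZF V)
include hV

theorem ext {x y : ZFSet.{u}} (hx : x ∈ V) (hy : y ∈ V) (h : ∀ z : V, z.1 ∈ x ↔ z.1 ∈ y) :
    x = y :=
  ZFSet.ext fun z => ⟨fun hz => (h ⟨z, hV.transitive x hx z hz⟩).1 hz,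
    fun hz => (h ⟨z, hV.transitive y hy z hz⟩).2 hz⟩

/-- An axiom of V yields a set with prescribed elements among those of V; by transitivity this is
the actual set. -/
theorem mem_of_forall_iff {x y : ZFSet.{u}} (hx : x ∈ V) (hy : ∀ z ∈ y, z ∈ V)
    (h : ∀ z : V, z.1 ∈ x ↔ z.1 ∈ y) : y ∈ V := by
  have : x = y := ZFSet.ext fun z => ⟨fun hz => (h ⟨z, hV.transitive x hx z hz⟩).1 hz,
    fun hz => (h ⟨z, hy z hz⟩).2 hz⟩
  rwa [← this]

theorem upair_mem {x y : ZFSet.{u}} (hx : x ∈ V) (hy : y ∈ V) : ({x, y} : ZFSet.{u}) ∈ V := by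
  obtain ⟨z, hz⟩ := hV.models.pairing ⟨x, hx⟩ ⟨y, hy⟩
  refine hV.mem_of_forall_iff z.2 ?_ fun w => ?_
  · intro w hw
    rcases ZFSet.mem_pair.1 hw with rfl | rfl <;> assumption
  · rw [hz, ZFSet.mem_pair, Subtype.ext_iff, Subtype.ext_iff]

theorem singleton_mem {x : ZFSet.{u}} (hx : x ∈ V) : ({x} : ZFSet.{u}) ∈ V := by
  simpa using hV.upair_mem hx hx

theorem pair_mem {x y : ZFSet.{u}} (hx : x ∈ V) (hy : y ∈ V) : ZFSet.pair x y ∈ V :=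
  hV.upair_mem (hV.singleton_mem hx) (hV.upair_mem hx hy)

theorem sUnion_mem {x : ZFSet.{u}} (hx : x ∈ V) : ZFSet.sUnion x ∈ V := by
  obtain ⟨y, hy⟩ := hV.models.union ⟨x, hx⟩
  refine hV.mem_of_forall_iff y.2 ?_ fun w => ?_
  · intro w hw
    obtain ⟨z, hz, hw⟩ := ZFSet.mem_sUnion.1 hw
    exact hV.transitive z (hV.transitive x hx z hz) w hw
  · rw [hy, ZFSet.mem_sUnion]
    exact ⟨fun ⟨z, hz⟩ => ⟨z, hz⟩, fun ⟨z, hz⟩ => ⟨⟨z, hV.transitive x hx z hz.1⟩, hz⟩⟩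

theorem union_mem {x y : ZFSet.{u}} (hx : x ∈ V) (hy : y ∈ V) : x ∪ y ∈ V := by
  rw [← ZFSet.sUnion_pair]
  exact hV.sUnion_mem (hV.upair_mem hx hy)

theorem insert_mem {x y : ZFSet.{u}} (hx : x ∈ V) (hy : y ∈ V) : insert x y ∈ V := by
  have : insert x y = {x} ∪ y := by
    ext z
    simp
  rw [this]
  exact hV.union_mem (hV.singleton_mem hx) hy

theorem empty_mem : (∅ : ZFSet.{u}) ∈ V := by
  obtain ⟨_, ⟨e, -, he⟩, -⟩ := hV.models.infinity
  exact hV.mem_of_forall_iff e.2 (by simp) fun z => by simpa using he z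

theorem finOrd_mem (n : ℕ) : finOrd n ∈ V := by
  induction n with
  | zero => exact hV.empty_mem
  | succ n ih => exact hV.insert_mem ih ih

theorem sep_mem {x : ZFSet.{u}} (hx : x ∈ V) {p : ZFSet.{u} → Prop}
    (hp : DefinablePred (fun v : Fin 1 → V => p (v 0))) : ZFSet.sep p x ∈ V := by
  obtain ⟨y, hy⟩ := hV.models.separation {z : V | p z} hp ⟨x, hx⟩
  refine hV.mem_of_forall_iff y.2 ?_ fun z => ?_
  · intro z hz
    exact hV.transitive x hx z (ZFSet.mem_sep.1 hz).1
  · rw [hy, ZFSet.mem_sep]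
    rfl

/-- The double power set, in V, of a ∪ b works. A superset of the product is enough, since
separation is applied afterwards. -/
theorem exists_pairs {a b : ZFSet.{u}} (ha : a ∈ V) (hb : b ∈ V) :
    ∃ D ∈ V, ∀ x ∈ a, ∀ y ∈ b, ZFSet.pair x y ∈ D := by
  obtain ⟨P, hP⟩ := hV.models.powerset ⟨a ∪ b, hV.union_mem ha hb⟩
  obtain ⟨Q, hQ⟩ := hV.models.powerset P
  refine ⟨Q, Q.2, fun x hx y hy => ?_⟩
  have hxV := hV.transitive a ha x hx
  have hyV := hV.transitive b hb y hy
  refine (hQ ⟨_, hV.pair_mem hxV hyV⟩).2 fun z hz => (hP z).2 fun w hw => ?_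
  simp only [ZFSet.pair, ZFSet.mem_pair] at hz
  simp only [ZFSet.mem_union]
  rcases hz with hz | hz <;> rw [hz] at hw <;> simp only [ZFSet.mem_singleton, ZFSet.mem_pair] at hw
  · exact .inl (hw ▸ hx)
  · rcases hw with hw | hw
    · exact .inl (hw ▸ hx)
    · exact .inr (hw ▸ hy)

theorem definablePred_eq_upair {n : ℕ} {f g h : (Fin n → V) → V} (hf : IsTermFun f)
    (hg : IsTermFun g) (hh : IsTermFun h) :
    DefinablePred (fun v => (h v : ZFSet) = {(f v : ZFSet), (g v : ZFSet)}) := by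
  have : DefinablePred (fun v => ∀ z : V, z.1 ∈ (h v).1 ↔ z = f v ∨ z = g v) :=
    .all (.iff (.mem (.coord 0) hh.tail) (.or (.eq (.coord 0) hf.tail) (.eq (.coord 0) hg.tail)))
  refine (congrArg DefinablePred (funext fun v => propext ?_)).mp this
  constructor
  · intro H
    refine hV.ext (h v).2 (hV.upair_mem (f v).2 (g v).2) fun z => ?_
    rw [H, ZFSet.mem_pair, Subtype.ext_iff, Subtype.ext_iff]
  · intro H z
    rw [H, ZFSet.mem_pair, Subtype.ext_iff, Subtype.ext_iff]

theorem definablePred_eq_pair {n : ℕ} {f g h : (Fin n → V) → V} (hf : IsTermFun f)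
    (hg : IsTermFun g) (hh : IsTermFun h) :
    DefinablePred (fun v => (h v : ZFSet) = ZFSet.pair (f v) (g v)) := by
  have : DefinablePred (fun v => ∃ s t : V, s.1 = {(f v : ZFSet), (f v : ZFSet)} ∧
      t.1 = {(f v : ZFSet), (g v : ZFSet)} ∧ (h v).1 = {s.1, t.1}) :=
    .ex (.ex (.and (hV.definablePred_eq_upair hf.tail.tail hf.tail.tail (.coord 1))
      (.and (hV.definablePred_eq_upair hf.tail.tail hg.tail.tail (.coord 0))
        (hV.definablePred_eq_upair (.coord 1) (.coord 0) hh.tail.tail))))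
  refine (congrArg DefinablePred (funext fun v => propext ?_)).mp this
  constructor
  · rintro ⟨s, t, hs, ht, H⟩
    rw [H, hs, ht, ZFSet.pair_eq_singleton, ZFSet.pair]
  · intro H
    exact ⟨⟨_, hV.upair_mem (f v).2 (f v).2⟩, ⟨_, hV.upair_mem (f v).2 (g v).2⟩, rfl, rfl,
      by simp [H, ZFSet.pair]⟩

theorem definablePred_pair_mem {n : ℕ} {f g h : (Fin n → V) → V} (hf : IsTermFun f)
    (hg : IsTermFun g) (hh : IsTermFun h) :
    DefinablePred (fun v => ZFSet.pair (f v) (g v) ∈ (h v : ZFSet)) := by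
  have : DefinablePred (fun v => ∃ p : V, p.1 = ZFSet.pair (f v) (g v) ∧ p.1 ∈ (h v).1) :=
    .ex (.and (hV.definablePred_eq_pair hf.tail hg.tail (.coord 0)) (.mem (.coord 0) hh.tail))
  refine (congrArg DefinablePred (funext fun v => propext ?_)).mp this
  constructor
  · rintro ⟨p, hp, H⟩
    rwa [← hp]
  · intro H
    exact ⟨⟨_, hV.pair_mem (f v).2 (g v).2⟩, rfl, H⟩

end IsTransitiveModelZF

-- The set of stacks belongs to the model

namespace RealizabilityAlgebra

variable {V : Set ZFSet.{u}} (𝒜 : RealizabilityAlgebra V)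

theorem mem_sUnion_sUnion_left {x y z : ZFSet.{u}} (h : ZFSet.pair x y ∈ z) :
    x ∈ ZFSet.sUnion (ZFSet.sUnion z) :=
  ZFSet.mem_sUnion_of_mem (z := {x, y}) (by simp)
    (ZFSet.mem_sUnion_of_mem (by simp [ZFSet.pair]) h)

theorem mem_sUnion_sUnion_right {x y z : ZFSet.{u}} (h : ZFSet.pair x y ∈ z) :
    y ∈ ZFSet.sUnion (ZFSet.sUnion z) :=
  ZFSet.mem_sUnion_of_mem (z := {x, y}) (by simp)
    (ZFSet.mem_sUnion_of_mem (by simp [ZFSet.pair]) h)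

/-- The set of the codes of the stacks. -/
noncomputable def stkSet : ZFSet.{u} := ZFSet.range (fun π : 𝒜.Stk => codeS π)

theorem mem_stkSet {z : ZFSet.{u}} : z ∈ 𝒜.stkSet ↔ ∃ π : 𝒜.Stk, codeS π = z := by
  simp [stkSet]

/-- The preorder is reflexive, so its code `R` in V contains (p, p) for every process p. Stacks are
the second components of processes, which avoids constructing them by recursion inside V. -/
theorem stkSet_mem (hV : IsTransitiveModelZF V) : 𝒜.stkSet ∈ V := by
  set R := ZFSet.range (fun p : {p : Proc (Elts 𝒜.A) (Elts 𝒜.B) × Proc (Elts 𝒜.A) (Elts 𝒜.B) //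
    𝒜.red p.1 p.2} => ZFSet.pair (codeP p.1.1) (codeP p.1.2)) with hR
  have hRV : R ∈ V := 𝒜.red_mem
  have hmem (p : Proc (Elts 𝒜.A) (Elts 𝒜.B)) : ZFSet.pair (codeP p) (codeP p) ∈ R := by
    rw [hR, ZFSet.mem_range]
    exact ⟨⟨(p, p), 𝒜.red_refl p⟩, rfl⟩
  -- Two unions lead from `R` to the codes of processes, and two more to their components.
  have key : ZFSet.sep (fun z => ∃ t q : V, q.1 = ZFSet.pair t.1 z ∧ ZFSet.pair q.1 q.1 ∈ R)
      (ZFSet.sUnion (ZFSet.sUnion (ZFSet.sUnion (ZFSet.sUnion R)))) ∈ V := by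
    refine hV.sep_mem (hV.sUnion_mem (hV.sUnion_mem (hV.sUnion_mem (hV.sUnion_mem hRV)))) ?_
    exact .ex (.ex (.and (hV.definablePred_eq_pair (.coord 1) (.coord 2) (.coord 0))
      (hV.definablePred_pair_mem (.coord 0) (.coord 0) (.const ⟨R, hRV⟩))))
  have hQ {q : ZFSet.{u}} (hq : q ∈ ZFSet.sUnion (ZFSet.sUnion R)) : q ∈ V :=
    hV.transitive _ (hV.sUnion_mem (hV.sUnion_mem hRV)) _ hq
  convert key using 1
  ext z
  rw [mem_stkSet, ZFSet.mem_sep]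
  constructor
  · rintro ⟨π, rfl⟩
    have h1 := mem_sUnion_sUnion_left (hmem (Term.cc, π))
    have h2 := hQ h1
    rw [codeP] at h1
    refine ⟨mem_sUnion_sUnion_right h1, ⟨_, ?_⟩, ⟨_, h2⟩, rfl, hmem _⟩
    exact hV.transitive _ (hV.sUnion_mem (hV.sUnion_mem (hV.sUnion_mem (hV.sUnion_mem hRV)))) _
      (mem_sUnion_sUnion_left h1)
  · rintro ⟨-, t, q, hq, hqR⟩
    rw [hR, ZFSet.mem_range] at hqR
    obtain ⟨p, hp⟩ := hqR
    have := (ZFSet.pair_injective hp).1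
    rw [hq, codeP] at this
    exact ⟨_, (ZFSet.pair_injective this).2⟩

/-! ## Recursive names of ordinals -/

/-- `z` is obtained from `y` by one step of the recursion for recursive names, where `g` gives the
recursive names of the elements of `y`. -/
def IsReishStep (P y z g : V) : Prop :=
  (∀ e : V, e.1 ∈ z.1 ↔ ∃ y' z' π : V, y'.1 ∈ y.1 ∧ π.1 ∈ P.1 ∧ ZFSet.pair y'.1 z'.1 ∈ g.1 ∧
    e.1 = ZFSet.pair z'.1 π.1) ∧
  ∀ y' : V, y'.1 ∈ y.1 → ∃ z' : V, ZFSet.pair y'.1 z'.1 ∈ g.1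

/-- `g` is closed under the recursion for recursive names. -/
def IsReishClosed (P g : V) : Prop :=
  ∀ y z : V, ZFSet.pair y.1 z.1 ∈ g.1 → IsReishStep P y z g

theorem definablePred_isReishStep (hV : IsTransitiveModelZF V) (P : V) {n : ℕ}
    {f g h : (Fin n → V) → V} (hf : IsTermFun f) (hg : IsTermFun g) (hh : IsTermFun h) :
    DefinablePred (fun v => IsReishStep P (f v) (g v) (h v)) := by
  unfold IsReishStep
  refine .and (.all (.iff (.mem (.coord 0) hg.tail) (.ex (.ex (.ex (.and ?_ (.and ?_
    (.and ?_ ?_)))))))) (.all (.imp (.mem (.coord 0) hf.tail) (.ex ?_)))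
  · exact .mem (.coord 2) hf.tail.tail.tail.tail
  · exact .mem (.coord 0) (.const P)
  · exact hV.definablePred_pair_mem (.coord 2) (.coord 1) hh.tail.tail.tail.tail
  · exact hV.definablePred_eq_pair (.coord 1) (.coord 0) (.coord 3)
  · exact hV.definablePred_pair_mem (.coord 1) (.coord 0) hh.tail.tail

theorem definablePred_isReishClosed (hV : IsTransitiveModelZF V) (P : V) {n : ℕ}
    {f : (Fin n → V) → V} (hf : IsTermFun f) :
    DefinablePred (fun v => IsReishClosed P (f v)) :=
  .all (.all (.imp (hV.definablePred_pair_mem (.coord 1) (.coord 0) hf.tail.tail)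
    (definablePred_isReishStep hV P (.coord 1) (.coord 0) hf.tail.tail)))

variable (hV : IsTransitiveModelZF V)
include hV

/-- Correctness of `g` on the elements of y is enough. The second clause of `IsReishStep` gives `g`
a value at each of them, so that no element of r(y) is missed. -/
theorem eq_reish_of_isReishStep {y z g : V}
    (hg : ∀ y' z' : V, y'.1 ∈ y.1 → ZFSet.pair y'.1 z'.1 ∈ g.1 → z'.1 = 𝒜.reish y'.1)
    (h : IsReishStep ⟨𝒜.stkSet, 𝒜.stkSet_mem hV⟩ y z g) : z.1 = 𝒜.reish y.1 := by
  have hy {y' : ZFSet.{u}} (h : y' ∈ y.1) : y' ∈ V := hV.transitive _ y.2 _ h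
  have hπ (π : 𝒜.Stk) : codeS π ∈ V :=
    hV.transitive _ (𝒜.stkSet_mem hV) _ (𝒜.mem_stkSet.2 ⟨π, rfl⟩)
  ext e
  rw [mem_reish]
  constructor
  · intro he
    obtain ⟨y', z', π, hy', hπ, hz', hez⟩ := (h.1 ⟨e, hV.transitive _ z.2 _ he⟩).1 he
    obtain ⟨π', hπ'⟩ := 𝒜.mem_stkSet.1 hπ
    refine ⟨y', hy', π', ?_⟩
    rw [← hg y' z' hy' hz', hπ']
    exact hez
  · rintro ⟨y', hy', π, rfl⟩
    obtain ⟨z', hz'⟩ := h.2 ⟨y', hy hy'⟩ hy'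
    have hz := hg ⟨y', hy hy'⟩ z' hy' hz'
    rw [← hz]
    exact (h.1 ⟨_, hV.pair_mem z'.2 (hπ π)⟩).2
      ⟨⟨y', hy hy'⟩, z', ⟨_, hπ π⟩, hy', 𝒜.mem_stkSet.2 ⟨π, rfl⟩, hz', rfl⟩

/-- A closed `g` is not assumed to be a function: ∈-induction on y forces its values. -/
theorem eq_reish_of_isReishClosed {g : V}
    (hg : IsReishClosed ⟨𝒜.stkSet, 𝒜.stkSet_mem hV⟩ g) (y z : V)
    (h : ZFSet.pair y.1 z.1 ∈ g.1) : z.1 = 𝒜.reish y.1 := by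
  obtain ⟨y, hy⟩ := y
  induction y using ZFSet.inductionOn generalizing z with
  | _ y ih => exact 𝒜.eq_reish_of_isReishStep hV (fun y' z' hy' => ih y' hy' z' y'.2) (hg _ _ h)

theorem isReishStep_reish {x : ZFSet.{u}} {y z g : V}
    (hg : ∀ e, e ∈ g.1 ↔ ∃ w ∈ x, e = ZFSet.pair w (𝒜.reish w)) (hy : y.1 ⊆ x)
    (hx : ∀ w ∈ x, 𝒜.reish w ∈ V) (hz : z.1 = 𝒜.reish y.1) :
    IsReishStep ⟨𝒜.stkSet, 𝒜.stkSet_mem hV⟩ y z g := by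
  constructor
  · intro e
    rw [hz, mem_reish]
    constructor
    · rintro ⟨w, hw, π, he⟩
      exact ⟨⟨w, hV.transitive _ y.2 _ hw⟩, ⟨_, hx w (hy hw)⟩,
        ⟨codeS π, hV.transitive _ (𝒜.stkSet_mem hV) _ (𝒜.mem_stkSet.2 ⟨π, rfl⟩)⟩, hw,
        𝒜.mem_stkSet.2 ⟨π, rfl⟩, (hg _).2 ⟨w, hy hw, rfl⟩, he⟩
    · rintro ⟨w, z', π, hw, hπ, hwz, he⟩
      obtain ⟨w', -, h⟩ := (hg _).1 hwz
      obtain ⟨rfl, h⟩ := ZFSet.pair_injective h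
      obtain ⟨π', hπ'⟩ := 𝒜.mem_stkSet.1 hπ
      exact ⟨w, hw, π', by rw [he, h, hπ']⟩
  · intro w hw
    exact ⟨⟨_, hx w (hy hw)⟩, (hg _).2 ⟨w, hy hw, rfl⟩⟩

/-- The values of `g` lie in ⋃⋃g, so r(x) is cut out by separation from a set of pairs of such
values and stacks. -/
theorem reish_mem_of_graph {x : ZFSet.{u}} (hx : x ∈ V) {g : V}
    (hg : ∀ e, e ∈ g.1 ↔ ∃ w ∈ x, e = ZFSet.pair w (𝒜.reish w)) : 𝒜.reish x ∈ V := by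
  obtain ⟨D, hD, hDp⟩ := hV.exists_pairs (hV.sUnion_mem (hV.sUnion_mem g.2)) (𝒜.stkSet_mem hV)
  have key : ZFSet.sep (fun e => ∃ y z π : V, y.1 ∈ x ∧ π.1 ∈ 𝒜.stkSet ∧
      ZFSet.pair y.1 z.1 ∈ g.1 ∧ e = ZFSet.pair z.1 π.1) D ∈ V := by
    refine hV.sep_mem hD (.ex (.ex (.ex (.and ?_ (.and ?_ (.and ?_ ?_))))))
    · exact .mem (.coord 2) (.const ⟨x, hx⟩)
    · exact .mem (.coord 0) (.const ⟨_, 𝒜.stkSet_mem hV⟩)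
    · exact hV.definablePred_pair_mem (.coord 2) (.coord 1) (.const g)
    · exact hV.definablePred_eq_pair (.coord 1) (.coord 0) (.coord 3)
  convert key using 1
  ext e
  rw [mem_reish, ZFSet.mem_sep]
  constructor
  · rintro ⟨w, hw, π, rfl⟩
    have h1 := (hg _).2 ⟨w, hw, rfl⟩
    have h2 := mem_sUnion_sUnion_right h1
    have h3 := 𝒜.mem_stkSet.2 ⟨π, rfl⟩
    exact ⟨hDp _ h2 _ h3, ⟨w, hV.transitive _ hx _ hw⟩,
      ⟨_, hV.transitive _ (hV.sUnion_mem (hV.sUnion_mem g.2)) _ h2⟩,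
      ⟨_, hV.transitive _ (𝒜.stkSet_mem hV) _ h3⟩, hw, h3, h1, rfl⟩
  · rintro ⟨-, y, z, π, hy, hπ, hyz, rfl⟩
    obtain ⟨w, -, h⟩ := (hg _).1 hyz
    obtain ⟨rfl, h⟩ := ZFSet.pair_injective h
    obtain ⟨π', hπ'⟩ := 𝒜.mem_stkSet.1 hπ
    exact ⟨y, hy, π', by rw [h, hπ']⟩

/-- Replacement in V collects the pairs (y, r(y)) for y ∈ x. Below an ordinal, each y is transitive,
so the graph of r on y is itself closed under the recursion and no transitive closure is needed. -/
theorem exists_reish_graph {x : ZFSet.{u}} (hx : x ∈ V) (ho : x.IsOrdinal) :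
    ∃ g : V, ∀ e, e ∈ g.1 ↔ ∃ w ∈ x, e = ZFSet.pair w (𝒜.reish w) := by
  induction x using ZFSet.inductionOn with
  | _ x ih =>
    have hmem {w : ZFSet.{u}} (hw : w ∈ x) : w ∈ V := hV.transitive x hx w hw
    have hr {w : ZFSet.{u}} (hw : w ∈ x) : 𝒜.reish w ∈ V := by
      obtain ⟨g, hg⟩ := ih w hw (hmem hw) (ho.mem hw)
      exact 𝒜.reish_mem_of_graph hV (hmem hw) hg
    let P : V := ⟨𝒜.stkSet, 𝒜.stkSet_mem hV⟩
    -- Quantifying over closed approximations `g` in V defines y ↦ (y, r(y)) on x without mentioning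
    -- r, hence first-order over V.
    let R : Set (V × V) := {p | ∃ z g : V, p.2.1 = ZFSet.pair p.1.1 z.1 ∧ IsReishClosed P g ∧
      IsReishStep P p.1 z g}
    have hR : DefinableRel (fun x y : V => (x : ZFSet) ∈ (y : ZFSet)) R := by
      have : DefinablePred (fun v : Fin 2 → V => ∃ z g : V,
          (v 1).1 = ZFSet.pair (v 0).1 z.1 ∧ IsReishClosed P g ∧ IsReishStep P (v 0) z g) :=
        -- Coordinates 0 and 1 are `g` and `z`; 2 and 3 are the argument and the value of `R`.
        .ex (.ex (.and (hV.definablePred_eq_pair (.coord 2) (.coord 1) (.coord 3))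
          (.and (definablePred_isReishClosed hV P (.coord 0))
            (definablePred_isReishStep hV P (.coord 2) (.coord 1) (.coord 0)))))
      exact this
    have hRiff (y w : V) (hy : y.1 ∈ x) : (y, w) ∈ R ↔ w.1 = ZFSet.pair y.1 (𝒜.reish y.1) := by
      constructor
      · rintro ⟨z, g, hw, hg, hz⟩
        rw [← 𝒜.eq_reish_of_isReishStep hV
          (fun y' z' _ => 𝒜.eq_reish_of_isReishClosed hV hg y' z') hz]
        exact hw
      · intro hw
        obtain ⟨g, hg⟩ := ih y.1 hy y.2 (ho.mem hy)
        have hyr : ∀ w ∈ y.1, 𝒜.reish w ∈ V := fun w hw => hr (ho.mem_trans hw hy)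
        refine ⟨⟨_, hr hy⟩, g, hw, ?_, 𝒜.isReishStep_reish hV hg (fun _ h => h) hyr rfl⟩
        intro a b hab
        obtain ⟨c, hc, h⟩ := (hg _).1 hab
        obtain ⟨rfl, h⟩ := ZFSet.pair_injective h
        exact 𝒜.isReishStep_reish hV hg ((ho.mem hy).subset_of_mem hc) hyr h
    obtain ⟨g, hg⟩ := hV.models.replacement R hR ⟨x, hx⟩ (by
      intro y hy
      refine ⟨⟨_, hV.pair_mem y.2 (hr hy)⟩, (hRiff _ _ hy).2 rfl, fun w hw => ?_⟩
      exact Subtype.ext ((hRiff _ _ hy).1 hw))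
    refine ⟨g, fun e => ⟨fun he => ?_, ?_⟩⟩
    · obtain ⟨y, hy, h⟩ := (hg ⟨e, hV.transitive _ g.2 _ he⟩).1 he
      exact ⟨y, hy, (hRiff _ _ hy).1 h⟩
    · rintro ⟨w, hw, rfl⟩
      exact (hg ⟨_, hV.pair_mem (hmem hw) (hr hw)⟩).2 ⟨⟨w, hmem hw⟩, hw, (hRiff _ _ hw).2 rfl⟩

theorem reish_mem_N {x : ZFSet.{u}} (hx : x ∈ V) (ho : x.IsOrdinal) : 𝒜.reish x ∈ 𝒜.N := by
  obtain ⟨g, hg⟩ := 𝒜.exists_reish_graph hV hx ho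
  exact ⟨𝒜.reish_mem_of_graph hV hx hg, 𝒜.isName_reish x⟩

end RealizabilityAlgebra

end RealizabilityZF

theorem mainTheorem10 (V : Set ZFSet.{u}) (hV : RealizabilityZF.IsTransitiveModelZF V)
    (𝒜 : RealizabilityZF.RealizabilityAlgebra V) :
    (∀ α β : ZFSet.{u}, α ∈ V → β ∈ V → α.IsOrdinal → β.IsOrdinal → α = insert β β →
      𝒜.Forces (RealizabilityZF.Fml.isSucc 0 1) ![𝒜.reish α, 𝒜.reish β] ∧
      𝒜.Forces (RealizabilityZF.Fml.simeqSucc 0 1) ![𝒜.reish α, 𝒜.reish β]) ∧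
    (∀ n : ℕ, 𝒜.Forces (RealizabilityZF.Fml.isNthSucc n 0)
      ![𝒜.reish (RealizabilityZF.finOrd n)]) := by
  have hfin (k : ℕ) : 𝒜.reish (RealizabilityZF.finOrd k) ∈ 𝒜.N :=
    𝒜.reish_mem_N hV (hV.finOrd_mem k) (RealizabilityZF.RealizabilityAlgebra.isOrdinal_finOrd k)
  constructor
  · rintro α β hα hβ hαo hβo rfl
    have hN : ∀ i, ![𝒜.reish (insert β β), 𝒜.reish β] i ∈ 𝒜.N := by
      intro i
      fin_cases i
      · exact 𝒜.reish_mem_N hV hα hαo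
      · exact 𝒜.reish_mem_N hV hβ hβo
    exact ⟨⟨hN, _, 𝒜.noCont_succTm, 𝒜.realizes_isSucc hβo rfl rfl⟩,
      ⟨hN, _, 𝒜.noCont_simeqSuccTm, 𝒜.realizes_simeqSucc hβo (hN 0) rfl rfl⟩⟩
  · intro n
    refine ⟨fun i => ?_, _, 𝒜.noCont_nthSuccTm n, 𝒜.realizes_isNthSucc hfin n rfl⟩
    fin_cases i
    exact hfin n
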